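/- For a Lebesgue measurable set $E\subset\mathbb{R}$, let $|E|$ denote its Lebesgue measure and let its 3-deck be the function $$N_E(x,y)=\bigl|E\cap(E-x)\cap(E-y)\bigr|\in[0,\infty],\qquad (x,y)\in\mathbb{R}^2 .$$ Call $E$ an open set with lower bounded gaps if $E$ is open and there is $\varepsilon>0$ such that $\mathbb{R}\setminus E$ can be written as a union of closed intervals each of length at least $\varepsilon$. Theorem. Let $E\subset\mathbb{R}$ be an open set with lower bounded gaps and $|E|<\infty$. Let $F\subset\mathbb{R}$ be any Lebesgue measurable set with the same 3-deck as $E$, that is, $N_F(x,y)=N_E(x,y)$ for almost every $(x,y)\in\mathbb{R}^2$. Then $F$ is a translate of $E$ up to a null set: there is $a\in\mathbb{R}$ such that $F$ and $E+a$ differ by a set of measure zero. -/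

import Mathlib

open MeasureTheory Set
open scoped ENNReal Pointwise

/-- The 3-deck of a set `E` of reals: `N_E(x, y) = |E ∩ (E - x) ∩ (E - y)|`, where `|·|` is
Lebesgue measure. -/
noncomputable def threeDeck (E : Set ℝ) (p : ℝ × ℝ) : ℝ≥0∞ :=
  volume (E ∩ ((-p.1) +ᵥ E) ∩ ((-p.2) +ᵥ E))

/-- Open sets with lower bounded gaps: `E` is open and its complement can be written as a union of
closed intervals whose lengths are bounded below by a positive constant. (An unbounded component
of the complement is the union of the closed intervals of length at least `ε` inside it.) -/
def IsOpenWithLowerBoundedGaps (E : Set ℝ) : Prop :=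
  IsOpen E ∧ ∃ ε : ℝ, 0 < ε ∧ ∃ S : Set (ℝ × ℝ),
    (∀ p ∈ S, ε ≤ p.2 - p.1) ∧ Eᶜ = ⋃ p ∈ S, Icc p.1 p.2

/-! The Fourier transform turns the 3-deck of `E` into the product `f(-(s+t)) f(s) f(t)`, with `f`
the transform of the indicator of `E`. Near 0, where `f` does not vanish, the ratio of the
transforms of `F` and `E` is therefore multiplicative and unimodular, hence a character; translating
`E` makes the two transforms agree near 0 (`exists_charFun_eq_exp_mul`). This alone does not
identify `F`, since `E` may be unbounded and the transform may have zeros. The gaps supply the rest.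
For small `y > 0`, points `t` and `t + y` of `E` bound an interval inside `E`, so finite measure
forces `E ∩ (E - y)` to be bounded. Slicing the deck at almost every `y` and dividing by `f(-s)`
shows that `F ∩ (F - y)` and `E ∩ (E - y)` have the same transform near 0. A boundedly supported
measure is determined among all finite measures by this germ (`measure_eq_of_charFun_eq_near_zero`),
so the two sets agree up to a null set. Letting `y → 0` gives `E ⊆ F` almost everywhere, and equal
finite measures give equality. -/

/-! ### Finite measures determined by their characteristic function near 0. -/

open Filter Topology ProbabilityTheory in
/-- Finite measures on a bounded interval are determined by the germ at `0` of their
characteristic function. -/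
theorem charFun_ext_of_bounded {μ ν : Measure ℝ} [IsFiniteMeasure μ] [IsFiniteMeasure ν] {R : ℝ}
    (hμ : μ {x | R ≤ |x|} = 0) (hν : ν {x | R ≤ |x|} = 0)
    (h : ∀ᶠ s in 𝓝 (0 : ℝ), charFun μ s = charFun ν s) : μ = ν := by
  have key : ∀ κ : Measure ℝ, IsFiniteMeasure κ → κ {x | R ≤ |x|} = 0 →
      AnalyticOnNhd ℂ (complexMGF id κ) univ := by
    intro κ _ hκ
    have huniv : integrableExpSet id κ = univ := by
      refine eq_univ_of_forall fun t => ?_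
      refine Integrable.of_bound (by fun_prop) (Real.exp (|t| * R)) ?_
      have : ∀ᵐ x ∂κ, |x| < R := by
        rw [ae_iff]; simpa using hκ
      filter_upwards [this] with x hx
      rw [Real.norm_eq_abs, Real.abs_exp, Real.exp_le_exp]
      calc t * id x ≤ |t * x| := le_abs_self _
        _ = |t| * |x| := abs_mul _ _
        _ ≤ |t| * R := by gcongr
    have := analyticOnNhd_complexMGF (X := id) (μ := κ)
    rw [huniv] at this
    simpa using this
  have hEq : complexMGF id μ = complexMGF id ν := by
    refine (key μ inferInstance hμ).eq_of_frequently_eq (z₀ := 0) (key ν inferInstance hν) ?_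
    -- Agreement is known only on the imaginary axis, but its points accumulate at 0, which suffices
    -- for the identity theorem.
    have hten : Tendsto (fun s : ℝ => (s : ℂ) * Complex.I) (𝓝[≠] 0) (𝓝[≠] 0) := by
      refine tendsto_nhdsWithin_iff.2 ⟨?_, ?_⟩
      · have : Continuous (fun s : ℝ => (s : ℂ) * Complex.I) := by fun_prop
        simpa using (this.tendsto 0).mono_left nhdsWithin_le_nhds
      · filter_upwards [self_mem_nhdsWithin] with s hs
        simpa using hs
    refine hten.frequently (Eventually.frequently ?_)
    filter_upwards [h.filter_mono nhdsWithin_le_nhds] with s hs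
    rw [complexMGF_id_mul_I, complexMGF_id_mul_I, hs]
  refine Measure.ext_of_charFun (funext fun s => ?_)
  rw [← complexMGF_id_mul_I, ← complexMGF_id_mul_I, hEq]

/-- If two characteristic functions agree near the origin, the measures give the same integral to
trigonometric polynomials of small frequency. -/
theorem integral_exp_mul_one_sub_cos_pow_eq {μ ν : Measure ℝ} [IsFiniteMeasure μ]
    [IsFiniteMeasure ν] {η : ℝ} (h : ∀ s, |s| < η → charFun μ s = charFun ν s) (s : ℝ) (n : ℕ) :
    ∀ c : ℝ, |c| + n * |s| < η →
      ∫ x, Complex.exp (c * x * Complex.I) * (1 - Complex.cos (s * x)) ^ n ∂μ =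
      ∫ x, Complex.exp (c * x * Complex.I) * (1 - Complex.cos (s * x)) ^ n ∂ν := by
  have hint : ∀ (κ : Measure ℝ) [IsFiniteMeasure κ] (c : ℝ) (n : ℕ), Integrable
      (fun x : ℝ => Complex.exp (c * x * Complex.I) * (1 - Complex.cos (s * x)) ^ n) κ := by
    intro κ _ c n
    refine Integrable.of_bound (by fun_prop) (2 ^ n) (ae_of_all _ fun x => ?_)
    rw [norm_mul, norm_pow, ← Complex.ofReal_mul, Complex.norm_exp_ofReal_mul_I, one_mul,
      ← Complex.ofReal_mul, ← Complex.ofReal_cos, ← Complex.ofReal_one, ← Complex.ofReal_sub,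
      Complex.norm_real]
    refine pow_le_pow_left₀ (norm_nonneg _) ?_ n
    rw [Real.norm_eq_abs, abs_le]
    constructor <;> linarith [Real.neg_one_le_cos (s * x), Real.cos_le_one (s * x)]
  -- Each factor `1 - cos (s x)` splits frequency `c` into `c` and `c ± s`; hence the quantifier
  -- over `c` and the budget `|c| + n |s| < η`.
  induction n with
  | zero =>
    intro c hc
    have := h c (by simpa using hc)
    simpa [charFun_apply_real] using this
  | succ n ih =>
    intro c hc
    have hs := abs_nonneg s
    push_cast at hc
    have e1 := ih c (by linarith)
    have e2 := ih (c + s) (by linarith [abs_add_le c s])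
    have e3 := ih (c - s) (by linarith [abs_sub c s])
    have hexp : ∀ κ : Measure ℝ, IsFiniteMeasure κ →
        ∫ x, Complex.exp (c * x * Complex.I) * (1 - Complex.cos (s * x)) ^ (n + 1) ∂κ =
        ∫ x, Complex.exp (c * x * Complex.I) * (1 - Complex.cos (s * x)) ^ n ∂κ
        - ((1 / 2 : ℂ) * ∫ x, Complex.exp ((c + s : ℝ) * x * Complex.I)
            * (1 - Complex.cos (s * x)) ^ n ∂κ
        + (1 / 2 : ℂ) * ∫ x, Complex.exp ((c - s : ℝ) * x * Complex.I)
            * (1 - Complex.cos (s * x)) ^ n ∂κ) := by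
      intro κ _
      rw [← integral_const_mul, ← integral_const_mul, ← integral_add, ← integral_sub]
      · refine integral_congr_ae (ae_of_all _ fun x => ?_)
        have a1 : Complex.exp ((c + s : ℝ) * x * Complex.I) =
            Complex.exp (c * x * Complex.I) * Complex.exp (s * x * Complex.I) := by
          rw [← Complex.exp_add]; push_cast; ring_nf
        have a2 : Complex.exp ((c - s : ℝ) * x * Complex.I) =
            Complex.exp (c * x * Complex.I) * Complex.exp (-(s * x) * Complex.I) := by
          rw [← Complex.exp_add]; push_cast; ring_nf
        have a3 : Complex.cos (s * x) =
          (Complex.exp (s * x * Complex.I) + Complex.exp (-(s * x) * Complex.I)) / 2 := rfl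
        simp only [a1, a2, pow_succ]
        rw [show (1 - Complex.cos (s * x)) ^ n * (1 - Complex.cos (s * x)) =
          (1 - Complex.cos (s * x)) ^ n * (1 - (Complex.exp (s * x * Complex.I) +
            Complex.exp (-(s * x) * Complex.I)) / 2) by rw [← a3]]
        ring
      · exact hint κ c n
      · exact ((hint κ _ n).const_mul _).add ((hint κ _ n).const_mul _)
      · exact (hint κ _ n).const_mul _
      · exact (hint κ _ n).const_mul _
    rw [hexp μ inferInstance, hexp ν inferInstance, e1, e2, e3]

theorem integral_one_sub_cos_pow_eq {μ ν : Measure ℝ} [IsFiniteMeasure μ]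
    [IsFiniteMeasure ν] {η : ℝ} (h : ∀ s, |s| < η → charFun μ s = charFun ν s) (s : ℝ) (n : ℕ)
    (hs : n * |s| < η) :
    ∫ x, (1 - Real.cos (s * x)) ^ n ∂μ = ∫ x, (1 - Real.cos (s * x)) ^ n ∂ν := by
  have := integral_exp_mul_one_sub_cos_pow_eq h s n 0 (by simpa using hs)
  simp only [Complex.ofReal_zero, zero_mul, Complex.exp_zero, one_mul] at this
  have cast : ∀ x : ℝ, (1 - Complex.cos (s * x)) ^ n = (((1 - Real.cos (s * x)) ^ n : ℝ) : ℂ) := by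
    intro x; push_cast; rfl
  simp only [cast, integral_complex_ofReal] at this
  exact_mod_cast this

/-- A finite measure whose characteristic function agrees near the origin with that of a measure
carried by a bounded interval is itself carried by a bounded interval. -/
theorem measure_bounded_of_charFun_eq {μ ν : Measure ℝ} [IsFiniteMeasure μ] [IsFiniteMeasure ν]
    {η R : ℝ} (hη : 0 < η) (hR : 0 < R) (h : ∀ s, |s| < η → charFun μ s = charFun ν s)
    (hν : ν {x | R ≤ |x|} = 0) : μ {x | Real.pi * R ≤ |x|} = 0 := by
  have hπ := Real.pi_pos
  have hν' : ∀ᵐ x ∂ν, |x| < R := by rw [ae_iff]; simpa using hν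
  have main : ∀ M : ℕ, μ {x | Real.pi * R ≤ |x| ∧ |x| ≤ M} = 0 := by
    intro M
    set A := {x : ℝ | Real.pi * R ≤ |x| ∧ |x| ≤ M} with hA
    have hAm : MeasurableSet A :=
      (measurableSet_le measurable_const measurable_norm).inter
        (measurableSet_le measurable_norm measurable_const)
    have hbound : ∀ n : ℕ, μ.real A ≤ (1 / 4 : ℝ) ^ n * ν.real univ := by
      intro n
      -- `s M ≤ π` gives a quadratic lower bound for `1 - cos (s x)` on `A`; `n s < η` keeps all
      -- frequencies where the transforms agree. The ratio of the two bounds below, `1/4` per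
      -- factor, is independent of `s`.
      obtain ⟨s, hs0, hs⟩ : ∃ s : ℝ, 0 < s ∧ s * M ≤ Real.pi ∧ n * s < η := by
        refine ⟨min (Real.pi / (M + 1)) (η / (n + 1)), by positivity, ?_, ?_⟩
        · calc _ ≤ Real.pi / (M + 1) * M := by gcongr; exact min_le_left _ _
            _ ≤ Real.pi := by
              rw [div_mul_eq_mul_div, div_le_iff₀ (by positivity)]; nlinarith
        · calc _ ≤ n * (η / (n + 1)) := by gcongr; exact min_le_right _ _
            _ < η := by
              rw [mul_div_assoc', div_lt_iff₀ (by positivity)]; nlinarith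
      have heq := integral_one_sub_cos_pow_eq h s n (by rw [abs_of_pos hs0]; exact hs.2)
      have hint : ∀ (κ : Measure ℝ) [IsFiniteMeasure κ], Integrable
          (fun x : ℝ => (1 - Real.cos (s * x)) ^ n) κ := by
        intro κ _
        refine Integrable.of_bound (by fun_prop) (2 ^ n) (ae_of_all _ fun x => ?_)
        rw [norm_pow]
        refine pow_le_pow_left₀ (norm_nonneg _) ?_ n
        rw [Real.norm_eq_abs, abs_le]
        constructor <;> linarith [Real.neg_one_le_cos (s * x), Real.cos_le_one (s * x)]
      have hnn : ∀ x : ℝ, 0 ≤ 1 - Real.cos (s * x) := fun x => by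
        linarith [Real.cos_le_one (s * x)]
      have up : ∫ x, (1 - Real.cos (s * x)) ^ n ∂ν ≤ (s ^ 2 * R ^ 2 / 2) ^ n * ν.real univ := by
        calc _ ≤ ∫ x, (s ^ 2 * R ^ 2 / 2) ^ n ∂ν := by
              refine integral_mono_ae (hint ν) (integrable_const _) ?_
              filter_upwards [hν'] with x hx
              refine pow_le_pow_left₀ (hnn x) ?_ n
              have h1 := Real.one_sub_sq_div_two_le_cos (x := s * x)
              have h2 : x ^ 2 ≤ R ^ 2 := sq_le_sq' (by linarith [(abs_lt.1 hx).1])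
                (abs_lt.1 hx).2.le
              have h3 : s ^ 2 * x ^ 2 ≤ s ^ 2 * R ^ 2 := by gcongr
              rw [mul_pow] at h1
              linarith
          _ = _ := by rw [integral_const, smul_eq_mul, mul_comm]
      have low : (2 * s ^ 2 * R ^ 2) ^ n * μ.real A ≤ ∫ x, (1 - Real.cos (s * x)) ^ n ∂μ := by
        calc _ = ∫ x in A, (2 * s ^ 2 * R ^ 2) ^ n ∂μ := by
              rw [setIntegral_const, smul_eq_mul, mul_comm]
          _ ≤ ∫ x in A, (1 - Real.cos (s * x)) ^ n ∂μ := by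
              refine setIntegral_mono_on (integrable_const _).integrableOn
                (hint μ).integrableOn hAm fun x hx => ?_
              refine pow_le_pow_left₀ (by positivity) ?_ n
              have hsx : |s * x| ≤ Real.pi := by
                rw [abs_mul, abs_of_pos hs0]
                exact (mul_le_mul_of_nonneg_left hx.2 hs0.le).trans hs.1
              have h1 := Real.cos_le_one_sub_mul_cos_sq hsx
              have h2 : (Real.pi * R) ^ 2 ≤ x ^ 2 := by
                rw [← sq_abs x]; exact pow_le_pow_left₀ (by positivity) hx.1 2
              have h3 : 2 * s ^ 2 * R ^ 2 = 2 / Real.pi ^ 2 * s ^ 2 * (Real.pi * R) ^ 2 := by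
                field_simp
              have h4 : 2 / Real.pi ^ 2 * s ^ 2 * (Real.pi * R) ^ 2 ≤
                2 / Real.pi ^ 2 * s ^ 2 * x ^ 2 := by gcongr
              rw [mul_pow] at h1
              linarith
          _ ≤ _ := setIntegral_le_integral (hint μ) (ae_of_all _ fun x => pow_nonneg (hnn x) n)
      have hpos : 0 < (2 * s ^ 2 * R ^ 2) ^ n := by positivity
      have hsplit : (s ^ 2 * R ^ 2 / 2) ^ n = (2 * s ^ 2 * R ^ 2) ^ n * (1 / 4) ^ n := by
        rw [← mul_pow (2 * s ^ 2 * R ^ 2) (1 / 4) n]; congr 1; ring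
      rw [hsplit, mul_assoc] at up
      exact le_of_mul_le_mul_left (low.trans (heq.le.trans up)) hpos
    have hlim : Filter.Tendsto (fun n : ℕ => (1 / 4 : ℝ) ^ n * ν.real univ) Filter.atTop
        (nhds 0) := by
      simpa using (tendsto_pow_atTop_nhds_zero_of_lt_one (by norm_num : (0 : ℝ) ≤ 1 / 4)
        (by norm_num)).mul_const (ν.real univ)
    have h0 : μ.real A = 0 :=
      le_antisymm (ge_of_tendsto' hlim hbound) measureReal_nonneg
    exact (measureReal_eq_zero_iff).1 h0
  refine measure_mono_null (t := ⋃ M : ℕ, {x : ℝ | Real.pi * R ≤ |x| ∧ |x| ≤ M}) ?_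
    (measure_iUnion_null main)
  intro x hx
  obtain ⟨M, hM⟩ := exists_nat_ge |x|
  exact mem_iUnion.2 ⟨M, hx, hM⟩

/-- Two finite measures, one of which is carried by a bounded interval, are equal as soon as their
characteristic functions agree near the origin. -/
theorem measure_eq_of_charFun_eq_near_zero {μ ν : Measure ℝ} [IsFiniteMeasure μ]
    [IsFiniteMeasure ν] {η R : ℝ} (hη : 0 < η) (hR : 0 < R)
    (h : ∀ s, |s| < η → charFun μ s = charFun ν s)
    (hν : ν {x | R ≤ |x|} = 0) : μ = ν := by
  have hμ := measure_bounded_of_charFun_eq hη hR h hν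
  refine charFun_ext_of_bounded hμ (measure_mono_null (fun x hx => ?_) hν) ?_
  · have : R ≤ Real.pi * R := by nlinarith [Real.pi_gt_three]
    exact this.trans hx
  · filter_upwards [Metric.ball_mem_nhds (0 : ℝ) hη] with s hs
    exact h s (by simpa using hs)

/-! ### Decks as densities, and their Fourier transforms. -/

/-- The law of `u - d z`, for `z` uniform on `A` and `u` uniform on `B`, has the cross-correlation
of `A` and `B` as density. -/
theorem map_sub_prod_restrict {G : Type*} [AddCommGroup G] [MeasureSpace G] [MeasurableAdd₂ G]
    [MeasurableSub₂ G] [SigmaFinite (volume : Measure G)]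
    [(volume : Measure G).IsAddLeftInvariant] {d : ℝ → G} (hd : Measurable d)
    {A : Set ℝ} (hA : MeasurableSet A) {B : Set G} (hB : MeasurableSet B) :
    (((volume : Measure ℝ).restrict A).prod ((volume : Measure G).restrict B)).map
      (fun p => p.2 - d p.1) = (volume : Measure G).withDensity
        (fun x => volume {z | z ∈ A ∧ d z + x ∈ B}) := by
  have hsub : Measurable (fun p : ℝ × G => p.2 - d p.1) :=
    measurable_snd.sub (hd.comp measurable_fst)
  ext S hS
  rw [Measure.map_apply hsub hS, withDensity_apply _ hS, Measure.prod_apply (hsub hS)]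
  -- Both sides are the product measure of `T`, sliced in the two orders; slices at fixed `z` use
  -- the substitution `u = d z + x`.
  set T : Set (ℝ × G) := {q | q.1 ∈ A ∧ q.2 ∈ S ∧ d q.1 + q.2 ∈ B} with hT
  have hTm : MeasurableSet T := (measurable_fst hA).inter ((measurable_snd hS).inter
    (((hd.comp measurable_fst).add measurable_snd) hB))
  calc _ = (volume.prod volume) T := ?_
    _ = _ := ?_
  · rw [Measure.prod_apply hTm, ← lintegral_indicator hA]
    refine lintegral_congr fun z => ?_
    by_cases hz : z ∈ A
    · rw [indicator_of_mem hz, Measure.restrict_apply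
        (measurable_prodMk_left (hsub hS))]
      rw [← measure_preimage_add volume (d z)]
      congr 1
      ext x
      simp [hT, hz]
    · rw [indicator_of_notMem hz]
      symm
      convert measure_empty (μ := (volume : Measure G))
      ext x
      simp [hT, hz]
  · rw [Measure.prod_apply_symm hTm, ← lintegral_indicator hS]
    refine lintegral_congr fun x => ?_
    by_cases hx : x ∈ S
    · rw [indicator_of_mem hx]
      congr 1
      ext z
      simp [hT, hx]
    · rw [indicator_of_notMem hx]
      convert measure_empty (μ := (volume : Measure ℝ))
      ext z
      simp [hT, hx]

theorem map_sub_prod_restrict_real {A B : Set ℝ} (hA : MeasurableSet A) (hB : MeasurableSet B) :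
    (((volume : Measure ℝ).restrict A).prod (volume.restrict B)).map (fun p => p.2 - p.1) =
      volume.withDensity (fun x : ℝ => volume (A ∩ ((-x) +ᵥ B))) := by
  refine (map_sub_prod_restrict measurable_id hA hB).trans ?_
  congr 1
  ext x
  congr 1
  ext z
  simp [mem_vadd_set_iff_neg_vadd_mem, add_comm]

theorem map_sub_prod_restrict_threeDeck {A : Set ℝ} (hA : MeasurableSet A) :
    (((volume : Measure ℝ).restrict A).prod ((volume.restrict A).prod (volume.restrict A))).map
      (fun p => p.2 - (p.1, p.1)) = volume.withDensity (threeDeck A) := by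
  have := map_sub_prod_restrict (G := ℝ × ℝ) (d := fun z => (z, z)) (by fun_prop) hA (hA.prod hA)
  rw [Measure.volume_eq_prod, ← Measure.prod_restrict] at this
  rw [this, Measure.volume_eq_prod]
  congr 1
  ext x
  rw [threeDeck]
  congr 1
  ext z
  simp only [mem_ofPred_eq, mem_prod, Prod.fst_add, Prod.snd_add, mem_inter_iff,
    mem_vadd_set_iff_neg_vadd_mem, neg_neg, vadd_eq_add, add_comm, and_assoc]

/-- The integral of the 3-deck is the cube of the measure. -/
theorem volume_eq_of_threeDeck_ae_eq {E F : Set ℝ} (hE : MeasurableSet E) (hF : MeasurableSet F)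
    (h : threeDeck F =ᵐ[volume] threeDeck E) : volume F = volume E := by
  have key : ∀ A : Set ℝ, MeasurableSet A → ∫⁻ p, threeDeck A p = volume A ^ 3 := by
    intro A hA
    have := congrArg (fun m => m univ) (map_sub_prod_restrict_threeDeck hA)
    simp only [withDensity_apply _ MeasurableSet.univ, Measure.restrict_univ] at this
    rw [← this, Measure.map_apply (by fun_prop) MeasurableSet.univ, preimage_univ,
      ← univ_prod_univ, Measure.prod_prod, ← univ_prod_univ, Measure.prod_prod]
    simp only [Measure.restrict_apply_univ]
    ring
  have h3 : volume F ^ 3 = volume E ^ 3 := by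
    rw [← key F hF, ← key E hE]; exact lintegral_congr_ae h
  exact (ENNReal.pow_right_strictMono (by norm_num : (3 : ℕ) ≠ 0)).injective h3

theorem integral_exp_map_sub_prod (μ ν : Measure ℝ) [IsFiniteMeasure μ] [IsFiniteMeasure ν]
    (s : ℝ) : ∫ x, Complex.exp (s * x * Complex.I) ∂((μ.prod ν).map (fun p => p.2 - p.1)) =
      charFun μ (-s) * charFun ν s := by
  rw [integral_map (by fun_prop) (by fun_prop), charFun_apply_real, charFun_apply_real,
    ← integral_prod_mul]
  refine integral_congr_ae (ae_of_all _ fun p => ?_)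
  simp only
  rw [← Complex.exp_add]
  push_cast
  ring_nf

theorem integral_exp_map_sub_prod_prod (μ : Measure ℝ) [IsFiniteMeasure μ] (s t : ℝ) :
    ∫ q : ℝ × ℝ, Complex.exp ((s * q.1 + t * q.2) * Complex.I)
      ∂((μ.prod (μ.prod μ)).map (fun p => p.2 - (p.1, p.1))) =
      charFun μ (-(s + t)) * (charFun μ s * charFun μ t) := by
  rw [integral_map (by fun_prop) (by fun_prop), charFun_apply_real, charFun_apply_real,
    charFun_apply_real, ← integral_prod_mul, ← integral_prod_mul]
  refine integral_congr_ae (ae_of_all _ fun p => ?_)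
  simp only [Prod.fst_sub, Prod.snd_sub]
  rw [← Complex.exp_add, ← Complex.exp_add]
  push_cast
  ring_nf

theorem charFun_mul_eq_of_threeDeck {E F : Set ℝ} (hE : MeasurableSet E) (hF : MeasurableSet F)
    [IsFiniteMeasure (volume.restrict E)] [IsFiniteMeasure (volume.restrict F)]
    (h : threeDeck F =ᵐ[volume] threeDeck E) (s t : ℝ) :
    charFun (volume.restrict F) (-(s + t)) *
      (charFun (volume.restrict F) s * charFun (volume.restrict F) t) =
    charFun (volume.restrict E) (-(s + t)) *
      (charFun (volume.restrict E) s * charFun (volume.restrict E) t) := by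
  rw [← integral_exp_map_sub_prod_prod, ← integral_exp_map_sub_prod_prod,
    map_sub_prod_restrict_threeDeck hE, map_sub_prod_restrict_threeDeck hF,
    withDensity_congr_ae h]

/-- For almost every shift `y`, the characteristic functions of `E ∩ (E - y)` and `E` have their
product determined by the 3-deck of `E`. -/
theorem ae_charFun_inter_mul_eq_of_threeDeck {E F : Set ℝ} (hE : MeasurableSet E)
    (hF : MeasurableSet F)
    [IsFiniteMeasure (volume.restrict E)] [IsFiniteMeasure (volume.restrict F)]
    (h : threeDeck F =ᵐ[volume] threeDeck E) :
    ∀ᵐ y : ℝ, ∀ s, charFun (volume.restrict (F ∩ ((-y) +ᵥ F))) s *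
        charFun (volume.restrict F) (-s) =
      charFun (volume.restrict (E ∩ ((-y) +ᵥ E))) s * charFun (volume.restrict E) (-s) := by
  rw [Measure.volume_eq_prod] at h
  have h' := Measure.ae_ae_of_ae_prod h
  filter_upwards [h'] with y hy s
  have hsl : ∀ A : Set ℝ, ∀ x, threeDeck A (y, x) = volume ((A ∩ ((-y) +ᵥ A)) ∩ ((-x) +ᵥ A)) :=
    fun A x => rfl
  have key : ∀ A : Set ℝ, MeasurableSet A → IsFiniteMeasure (volume.restrict A) →
      charFun (volume.restrict (A ∩ ((-y) +ᵥ A))) s * charFun (volume.restrict A) (-s) =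
      ∫ x, Complex.exp ((-s : ℝ) * x * Complex.I)
        ∂(volume.withDensity (fun x => threeDeck A (y, x))) := by
    intro A hA _
    have : IsFiniteMeasure (volume.restrict (A ∩ ((-y) +ᵥ A))) :=
      isFiniteMeasure_of_le (volume.restrict A) (Measure.restrict_mono inter_subset_left le_rfl)
    simp only [hsl]
    rw [← map_sub_prod_restrict_real (hA.inter (hA.const_vadd (-y))) hA, integral_exp_map_sub_prod,
      neg_neg]
  rw [key F hF inferInstance, key E hE inferInstance, withDensity_congr_ae hy]

/-! ### Recovering the phase near 0. -/

open Filter Topology in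
/-- A function continuous and multiplicative near `0` is an exponential near `0`. -/
theorem exists_eq_exp_of_mul_near_zero {φ : ℝ → ℂ} {r : ℝ} (hr : 0 < r)
    (hcont : ContinuousOn φ (Metric.ball 0 r)) (h0 : φ 0 = 1)
    (hmul : ∀ s t, |s| < r → |t| < r → |s + t| < r → φ (s + t) = φ s * φ t) :
    ∃ k : ℂ, ∃ η > 0, ∀ s : ℝ, |s| < η → φ s = Complex.exp (k * s) := by
  have hball : ∀ s, |s| < r → s ∈ Metric.ball (0 : ℝ) r := fun s hs => by simpa using hs
  have hat : ∀ s, |s| < r → ContinuousAt φ s := fun s hs =>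
    hcont.continuousAt (Metric.isOpen_ball.mem_nhds (hball s hs))
  obtain ⟨δ, hδ, hδ'⟩ := Metric.continuousAt_iff.1 (hat 0 (by simpa using hr)) (1 / 2) (by norm_num)
  simp only [sub_zero, h0, dist_eq_norm] at hδ'
  set η := min δ r / 2 with hη
  have hηpos : 0 < η := by positivity
  have hηr : 2 * η ≤ r := by rw [hη]; linarith [min_le_right δ r]
  have hηδ : 2 * η ≤ δ := by rw [hη]; linarith [min_le_left δ r]
  have hii : ∀ a b, |a| < r → |b| < r → IntervalIntegrable φ volume a b := by
    intro a b ha hb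
    refine (hcont.mono fun x hx => hball x ?_).intervalIntegrable
    have h1 := abs_lt.1 ha
    have h2 := abs_lt.1 hb
    rw [mem_uIcc] at hx
    rw [abs_lt]
    rcases hx with hx | hx <;> constructor <;> linarith
  -- Integrating `φ (s + t) = φ s * φ t` over `t` in `[0, η]` writes `c * φ s` as a difference of
  -- primitives, so `φ` is differentiable once `c ≠ 0`; the latter holds because `φ` stays within
  -- `1/2` of 1.
  set c := ∫ t in (0 : ℝ)..η, φ t with hc
  have hc0 : c ≠ 0 := by
    intro hc0
    have h1 : ‖∫ t in (0 : ℝ)..η, (φ t - 1)‖ ≤ 1 / 2 * |η - 0| := by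
      refine intervalIntegral.norm_integral_le_of_norm_le_const fun t ht => ?_
      rw [uIoc_of_le hηpos.le] at ht
      exact (hδ' (by rw [Real.norm_eq_abs, abs_of_pos ht.1]; linarith [ht.2])).le
    rw [intervalIntegral.integral_sub (hii 0 η (by simpa using hr)
      (by rw [abs_of_pos hηpos]; linarith)) (by simp), ← hc, hc0] at h1
    simp [abs_of_pos hηpos] at h1
    linarith
  set k := (φ η - 1) / c with hk
  have hder : ∀ s, |s| < r → HasDerivAt (fun s => ∫ t in (0 : ℝ)..s, φ t) (φ s) s := by
    intro s hs
    exact intervalIntegral.integral_hasDerivAt_right (hii 0 s (by simpa using hr) hs)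
      (hcont.stronglyMeasurableAtFilter Metric.isOpen_ball s (hball s hs)) (hat s hs)
  have hrep : ∀ s, |s| < η →
      φ s = ((∫ t in (0 : ℝ)..(s + η), φ t) - ∫ t in (0 : ℝ)..s, φ t) / c := by
    intro s hs
    have hs' := abs_lt.1 hs
    have h1 : |s| < r := by linarith
    have h2 : |s + η| < r := by rw [abs_lt]; constructor <;> linarith
    rw [eq_div_iff hc0, intervalIntegral.integral_interval_sub_left
      (hii _ _ (by simpa using hr) h2) (hii _ _ (by simpa using hr) h1), hc,
      ← intervalIntegral.integral_const_mul]
    have := intervalIntegral.integral_comp_add_left (a := 0) (b := η) φ s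
    rw [add_zero] at this
    rw [← this]
    refine intervalIntegral.integral_congr fun t ht => ?_
    rw [uIcc_of_le hηpos.le] at ht
    refine (hmul s t h1 ?_ ?_).symm
    · rw [abs_lt]; constructor <;> linarith [ht.1, ht.2]
    · rw [abs_lt]; constructor <;> linarith [ht.1, ht.2]
  have hφder : ∀ s, |s| < η → HasDerivAt φ (k * φ s) s := by
    intro s hs
    have hs' := abs_lt.1 hs
    have h1 : |s| < r := by linarith
    have h2 : |s + η| < r := by rw [abs_lt]; constructor <;> linarith
    have h3 := (((hder (s + η) h2).comp_add_const s η).sub (hder s h1)).div_const c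
    have h4 : (φ (s + η) - φ s) / c = k * φ s := by
      rw [hmul s η h1 (by rw [abs_of_pos hηpos]; linarith) h2, hk]; ring
    rw [h4] at h3
    refine h3.congr_of_eventuallyEq ?_
    filter_upwards [(isOpen_lt continuous_abs continuous_const).mem_nhds hs] with x hx
    exact hrep x hx
  refine ⟨k, η, hηpos, fun s hs => ?_⟩
  have hψ : ∀ s, |s| < η →
      HasDerivAt (fun s : ℝ => φ s * Complex.exp (-k * s)) 0 s := by
    intro s hs
    have h1 : HasDerivAt (fun s : ℝ => Complex.exp (-k * s))
        (Complex.exp (-k * s) * (-k * 1)) s :=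
      ((Complex.ofRealCLM.hasDerivAt (x := s)).const_mul (-k)).cexp
    exact ((hφder s hs).mul h1).congr_deriv (by ring)
  have hconst := Metric.isOpen_ball.is_const_of_deriv_eq_zero (s := Metric.ball (0 : ℝ) η)
    (f := fun s : ℝ => φ s * Complex.exp (-k * s)) (convex_ball (0 : ℝ) η).isPreconnected
    (fun x hx => (hψ x (by simpa using hx)).differentiableAt.differentiableWithinAt)
    (fun x hx => (hψ x (by simpa using hx)).deriv)
    (x := s) (y := 0) (by simpa using hs) (by simpa using hηpos)
  simp only [h0, Complex.ofReal_zero, mul_zero, Complex.exp_zero, mul_one] at hconst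
  rw [neg_mul, Complex.exp_neg] at hconst
  exact (mul_inv_eq_one₀ (Complex.exp_ne_zero _)).1 hconst

/-- Finite measures with the same triple correlation have, near the origin, the same characteristic
function up to a character. -/
theorem exists_charFun_eq_exp_mul {μ ν : Measure ℝ} [IsFiniteMeasure μ] [IsFiniteMeasure ν]
    (hν : ν ≠ 0) (hμν : μ univ = ν univ)
    (h : ∀ s t, charFun μ (-(s + t)) * (charFun μ s * charFun μ t) =
      charFun ν (-(s + t)) * (charFun ν s * charFun ν t)) :
    ∃ a : ℝ, ∃ η > 0, ∀ s : ℝ, |s| < η →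
      charFun μ s = charFun ν s * Complex.exp (a * s * Complex.I) ∧ charFun ν s ≠ 0 := by
  have hzero : charFun μ 0 = charFun ν 0 := by
    rw [charFun_zero, charFun_zero, measureReal_def, measureReal_def, hμν]
  have hν0 : charFun ν 0 ≠ 0 := by
    rw [charFun_zero]
    simpa [measureReal_eq_zero_iff] using hν
  obtain ⟨r, hr, hr'⟩ : ∃ r > 0, ∀ s, |s| < r → charFun μ s ≠ 0 ∧ charFun ν s ≠ 0 := by
    have h1 := continuous_charFun (μ := μ).continuousAt.eventually_ne (hzero ▸ hν0)
    have h2 := continuous_charFun (μ := ν).continuousAt.eventually_ne hν0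
    obtain ⟨r, hr, hr'⟩ := Metric.eventually_nhds_iff.1 (h1.and h2)
    exact ⟨r, hr, fun s hs => hr' (by simpa using hs)⟩
  set φ : ℝ → ℂ := fun s => charFun μ s / charFun ν s with hφ
  have hφ0 : φ 0 = 1 := by simp only [hφ, hzero]; exact div_self hν0
  have htriple : ∀ s t, |s| < r → |t| < r → |s + t| < r → φ (-(s + t)) * (φ s * φ t) = 1 := by
    intro s t hs ht hst
    have hst' : |(-(s + t))| < r := by rwa [abs_neg]
    have n1 := (hr' _ hst').2
    have n2 := (hr' _ hs).2
    have n3 := (hr' _ ht).2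
    simp only [hφ]
    rw [div_mul_div_comm, div_mul_div_comm, h s t]
    exact div_self (mul_ne_zero n1 (mul_ne_zero n2 n3))
  have hinv : ∀ s, |s| < r → φ (-s) * φ s = 1 := by
    intro s hs
    simpa [hφ0] using htriple s 0 hs (by simpa using hr) (by simpa using hs)
  obtain ⟨k, η, hη, hexp⟩ := exists_eq_exp_of_mul_near_zero (φ := φ) hr
    (fun s hs => (continuous_charFun.continuousAt.div continuous_charFun.continuousAt
      (hr' s (by simpa using hs)).2).continuousWithinAt) hφ0 (fun s t hs ht hst => by
      have h1 := htriple s t hs ht hst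
      have h2 := hinv (s + t) hst
      exact mul_left_cancel₀ (left_ne_zero_of_mul_eq_one h2) (h2.trans h1.symm))
  -- Transforms of real measures satisfy `φ (-s) = conj (φ s)`, so `φ (-s) * φ s = 1` means `|φ s| =
  -- 1`.
  have hkre : k.re = 0 := by
    have hs0 : 0 < min η r / 2 := by positivity
    set s := min η r / 2 with hs
    have hsabs : |s| = s := abs_of_pos hs0
    have h1 : |s| < η := by rw [hsabs]; linarith [min_le_left η r]
    have h2 : |s| < r := by rw [hsabs]; linarith [min_le_right η r]
    have h3 : φ (-s) = (starRingEnd ℂ) (φ s) := by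
      simp only [hφ, charFun_neg, map_div₀]
    have h4 := hinv s h2
    rw [h3, ← Complex.normSq_eq_conj_mul_self] at h4
    have h5 : ‖φ s‖ ^ 2 = 1 := by
      rw [← Complex.normSq_eq_norm_sq]; exact_mod_cast h4
    rw [hexp s h1, Complex.norm_exp, ← Real.exp_nat_mul, Real.exp_eq_one_iff] at h5
    simp only [Complex.mul_re, Complex.ofReal_re, Complex.ofReal_im, mul_zero, sub_zero] at h5
    have : k.re * s = 0 := by simpa using h5
    exact (mul_eq_zero.1 this).resolve_right hs0.ne'
  have hk : k = k.im * Complex.I := by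
    apply Complex.ext <;> simp [hkre]
  refine ⟨k.im, min η r, by positivity, fun s hs => ?_⟩
  have hn := (hr' s (hs.trans_le (min_le_right _ _))).2
  refine ⟨?_, hn⟩
  have := hexp s (hs.trans_le (min_le_left _ _))
  simp only [hφ] at this
  rw [div_eq_iff hn, hk] at this
  rw [this, mul_comm]
  ring_nf

/-! ### Translations and the geometry of lower bounded gaps. -/

theorem mem_neg_vadd_iff {E : Set ℝ} {h t : ℝ} : t ∈ ((-h) +ᵥ E : Set ℝ) ↔ t + h ∈ E := by
  rw [mem_vadd_set_iff_neg_vadd_mem, neg_neg, vadd_eq_add, add_comm]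

theorem threeDeck_vadd (a : ℝ) (E : Set ℝ) : threeDeck (a +ᵥ E) = threeDeck E := by
  ext p
  simp only [threeDeck]
  rw [vadd_comm (-p.1) a E, vadd_comm (-p.2) a E, ← vadd_set_inter, ← vadd_set_inter,
    measure_vadd]

theorem threeDeck_congr_ae {E F : Set ℝ} (h : E =ᵐ[volume] F) : threeDeck E = threeDeck F := by
  have hv : ∀ a : ℝ, (a +ᵥ E : Set ℝ) =ᵐ[volume] (a +ᵥ F : Set ℝ) := fun a =>
    (vadd_set_ae_eq a).2 h
  ext p
  exact measure_congr ((h.inter (hv _)).inter (hv _))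

theorem charFun_restrict_vadd (a : ℝ) (E : Set ℝ) (s : ℝ) :
    charFun (volume.restrict (a +ᵥ E : Set ℝ)) s =
      charFun (volume.restrict E) s * Complex.exp (a * s * Complex.I) := by
  have hmap : volume.restrict (a +ᵥ E : Set ℝ) = (volume.restrict E).map (a + ·) := by
    ext S hS
    rw [Measure.map_apply (by fun_prop) hS, Measure.restrict_apply hS,
      Measure.restrict_apply (measurable_const_add a hS), ← measure_preimage_add volume a]
    congr 1
    ext x
    simp [mem_vadd_set_iff_neg_vadd_mem]
  rw [hmap, charFun_map_const_add]
  simp [mul_comm]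

/-- In a set with lower bounded gaps, two points at small distance lie in the same component. -/
theorem IsOpenWithLowerBoundedGaps.exists_Icc_subset {E : Set ℝ}
    (hE : IsOpenWithLowerBoundedGaps E) :
    ∃ ε > 0, ∀ h, 0 < h → h < ε → ∀ t ∈ E, t + h ∈ E → Icc t (t + h) ⊆ E := by
  obtain ⟨-, ε, hε, S, hS, hcompl⟩ := hE
  refine ⟨ε, hε, fun h _ hhε t ht hth x hx => ?_⟩
  by_contra hxE
  have hsub : ∀ p ∈ S, ∀ y ∈ E, y ∉ Icc p.1 p.2 := by
    intro p hp y hy hyp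
    have : y ∈ Eᶜ := hcompl ▸ mem_biUnion hp hyp
    exact this hy
  have hx' : x ∈ Eᶜ := hxE
  rw [hcompl, mem_iUnion₂] at hx'
  obtain ⟨p, hp, hxp⟩ := hx'
  have h1 : t < p.1 := by
    by_contra hc
    exact hsub p hp t ht ⟨not_lt.1 hc, hx.1.trans hxp.2⟩
  have h2 : p.2 < t + h := by
    by_contra hc
    exact hsub p hp _ hth ⟨hxp.1.trans hx.2, not_lt.1 hc⟩
  linarith [hS p hp]

-- The tails of `E` have measure tending to 0, whereas a far-out pair `t`, `t + h` would put an
-- interval of length `h` in a tail of measure less than `h`.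
open Filter Topology in
theorem exists_bound_of_Icc_subset {E : Set ℝ} (hE : MeasurableSet E) (hfin : volume E < ∞)
    {h : ℝ} (hh : 0 < h) (hIcc : ∀ t ∈ E, t + h ∈ E → Icc t (t + h) ⊆ E) :
    ∃ R > 0, ∀ t ∈ E, t + h ∈ E → |t| < R := by
  set T : ℕ → Set ℝ := fun n => E ∩ {x | (n : ℝ) ≤ |x|} with hT
  have hTm : ∀ n, MeasurableSet (T n) := fun n =>
    hE.inter (measurableSet_le measurable_const measurable_norm)
  have hanti : Antitone T := fun m n hmn x hx =>
    ⟨hx.1, (Nat.cast_le.2 hmn : (m : ℝ) ≤ n).trans hx.2⟩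
  have hempty : ⋂ n, T n = ∅ := by
    refine eq_empty_of_forall_notMem fun x hx => ?_
    obtain ⟨n, hn⟩ := exists_nat_gt |x|
    exact absurd (mem_iInter.1 hx n).2 (not_le.2 hn)
  have hlim : Tendsto (fun n => volume (T n)) atTop (𝓝 0) := by
    have := tendsto_measure_iInter_atTop (μ := volume) (fun n => (hTm n).nullMeasurableSet) hanti
      ⟨0, ((measure_mono inter_subset_left).trans_lt hfin).ne⟩
    rwa [hempty, measure_empty] at this
  obtain ⟨n, hn⟩ := ((tendsto_order.1 hlim).2 (ENNReal.ofReal h) (by simpa using hh)).exists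
  refine ⟨n + h, by positivity, fun t ht hth => ?_⟩
  by_contra hc
  have hsub : Icc t (t + h) ⊆ T n := fun x hx => by
    refine ⟨hIcc t ht hth hx, ?_⟩
    have h1 : |t| - |x| ≤ |t - x| := abs_sub_abs_le_abs_sub t x
    have h2 : |t - x| ≤ h := by rw [abs_le]; constructor <;> linarith [hx.1, hx.2]
    show (n : ℝ) ≤ |x|
    linarith [not_lt.1 hc]
  have h3 := (measure_mono hsub).trans_lt hn
  rw [Real.volume_Icc, add_sub_cancel_left] at h3
  exact lt_irrefl _ h3

/-- An open set is almost contained in `F` if `E ∩ (E - h)` is, for arbitrarily small `h`. -/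
theorem IsOpen.measure_diff_eq_zero_of_inter_vadd {E F : Set ℝ} (hE : IsOpen E)
    (h : ∀ δ > 0, ∃ y : ℝ, 0 < y ∧ y < δ ∧ volume ((E ∩ ((-y) +ᵥ E)) \ F) = 0) :
    volume (E \ F) = 0 := by
  choose! y hy0 hyδ hy using h
  refine measure_mono_null (t := ⋃ n : ℕ, (E ∩ ((-(y (1 / (n + 1)))) +ᵥ E)) \ F) ?_
    (measure_iUnion_null fun n => hy _ (by positivity))
  intro x hx
  obtain ⟨δ, hδ, hball⟩ := Metric.isOpen_iff.1 hE x hx.1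
  obtain ⟨n, hn⟩ := exists_nat_one_div_lt hδ
  have hpos : (0 : ℝ) < 1 / (n + 1) := by positivity
  refine mem_iUnion.2 ⟨n, ⟨hx.1, mem_neg_vadd_iff.2 (hball ?_)⟩, hx.2⟩
  have h1 := hy0 _ hpos
  have h2 := hyδ _ hpos
  simp only [Metric.mem_ball, Real.dist_eq, add_sub_cancel_left, abs_of_pos h1]
  linarith

/-! ### Identification of `F`. -/

theorem measure_restrict_inter_eq_of_charFun {E F : Set ℝ} (hE : MeasurableSet E)
    [IsFiniteMeasure (volume.restrict E)] [IsFiniteMeasure (volume.restrict F)] {η y : ℝ}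
    (hη : 0 < η) (hy : 0 < y) (hIcc : ∀ t ∈ E, t + y ∈ E → Icc t (t + y) ⊆ E)
    (hnear : ∀ s : ℝ, |s| < η → charFun (volume.restrict F) s = charFun (volume.restrict E) s ∧
      charFun (volume.restrict E) s ≠ 0)
    (hmul : ∀ s, charFun (volume.restrict (F ∩ ((-y) +ᵥ F))) s *
        charFun (volume.restrict F) (-s) =
      charFun (volume.restrict (E ∩ ((-y) +ᵥ E))) s * charFun (volume.restrict E) (-s)) :
    volume.restrict (F ∩ ((-y) +ᵥ F)) = volume.restrict (E ∩ ((-y) +ᵥ E)) := by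
  have : IsFiniteMeasure (volume.restrict (E ∩ ((-y) +ᵥ E))) :=
    isFiniteMeasure_of_le (volume.restrict E) (Measure.restrict_mono inter_subset_left le_rfl)
  have : IsFiniteMeasure (volume.restrict (F ∩ ((-y) +ᵥ F))) :=
    isFiniteMeasure_of_le (volume.restrict F) (Measure.restrict_mono inter_subset_left le_rfl)
  have hfin : volume E < ∞ := by simpa using measure_lt_top (volume.restrict E) univ
  obtain ⟨R, hR, hbound⟩ := exists_bound_of_Icc_subset hE hfin hy hIcc
  refine measure_eq_of_charFun_eq_near_zero hη hR (fun s hs => ?_) ?_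
  · have h1 := hnear (-s) (by rwa [abs_neg])
    have h2 := hmul s
    rw [h1.1] at h2
    exact mul_right_cancel₀ h1.2 h2
  · have hm : MeasurableSet {x : ℝ | R ≤ |x|} := measurableSet_le measurable_const measurable_norm
    rw [Measure.restrict_apply hm]
    convert measure_empty (μ := (volume : Measure ℝ))
    refine eq_empty_of_forall_notMem fun t ht => ?_
    exact absurd ht.1 (not_le.2 (hbound t ht.2.1 (mem_neg_vadd_iff.1 ht.2.2)))

theorem exists_ae_eq_vadd_of_threeDeck {E F : Set ℝ} (hE : IsOpenWithLowerBoundedGaps E)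
    (hEfin : volume E < ∞) (hF : MeasurableSet F)
    (hdeck : threeDeck F =ᵐ[volume] threeDeck E) : ∃ a : ℝ, F =ᵐ[volume] (a +ᵥ E : Set ℝ) := by
  have hEo : IsOpen E := hE.1
  have hEm : MeasurableSet E := hEo.measurableSet
  have hvol : volume F = volume E := volume_eq_of_threeDeck_ae_eq hEm hF hdeck
  rcases eq_or_ne (volume E) 0 with h0 | h0
  · refine ⟨0, ?_⟩
    rw [zero_vadd]
    exact (ae_eq_empty.2 (hvol.trans h0)).trans (ae_eq_empty.2 h0).symm
  have : IsFiniteMeasure (volume.restrict E) := ⟨by simpa using hEfin⟩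
  have : IsFiniteMeasure (volume.restrict F) := ⟨by simpa [hvol] using hEfin⟩
  obtain ⟨a, η, hη, hnear⟩ := exists_charFun_eq_exp_mul
    (μ := volume.restrict F) (ν := volume.restrict E)
    (by simpa [Measure.restrict_eq_zero] using h0) (by simpa using hvol)
    (charFun_mul_eq_of_threeDeck hEm hF hdeck)
  refine ⟨a, ?_⟩
  set E' : Set ℝ := a +ᵥ E with hE'
  have hE'o : IsOpen E' := hEo.vadd a
  have hE'vol : volume E' = volume E := measure_vadd _ _ _
  have : IsFiniteMeasure (volume.restrict E') := ⟨by simpa [hE'vol] using hEfin⟩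
  have hnear' : ∀ s : ℝ, |s| < η →
      charFun (volume.restrict F) s = charFun (volume.restrict E') s ∧
        charFun (volume.restrict E') s ≠ 0 := by
    intro s hs
    rw [hE', charFun_restrict_vadd a E]
    exact ⟨(hnear s hs).1, mul_ne_zero (hnear s hs).2 (Complex.exp_ne_zero _)⟩
  obtain ⟨ε, hε, hIcc⟩ := hE.exists_Icc_subset
  have hmem : ∀ t, t ∈ E' ↔ -a + t ∈ E := fun t => by
    rw [hE', mem_vadd_set_iff_neg_vadd_mem, vadd_eq_add]
  have hIcc' : ∀ h, 0 < h → h < ε → ∀ t ∈ E', t + h ∈ E' → Icc t (t + h) ⊆ E' := by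
    intro h hh hhε t ht hth x hx
    rw [hmem] at ht hth ⊢
    rw [← add_assoc] at hth
    exact hIcc h hh hhε _ ht hth ⟨by linarith [hx.1], by linarith [hx.2]⟩
  have hgood := ae_charFun_inter_mul_eq_of_threeDeck (E := E') hE'o.measurableSet hF
    (by rwa [hE', threeDeck_vadd])
  have hsub : volume (E' \ F) = 0 := by
    refine hE'o.measure_diff_eq_zero_of_inter_vadd fun δ hδ => ?_
    -- The slice identity holds only for almost every shift, but an interval of positive length
    -- contains a good one.
    obtain ⟨y, hy, hmul⟩ := Measure.exists_mem_of_measure_ne_zero_of_ae (μ := volume)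
      (s := Ioo 0 (min δ ε)) (by simp [hδ, hε]) (ae_restrict_of_ae hgood)
    refine ⟨y, hy.1, hy.2.trans_le (min_le_left _ _), ?_⟩
    have heq := measure_restrict_inter_eq_of_charFun hE'o.measurableSet hη hy.1
      (hIcc' y hy.1 (hy.2.trans_le (min_le_right _ _))) hnear' hmul
    have h1 : volume.restrict (E' ∩ ((-y) +ᵥ E')) Fᶜ = 0 := by
      rw [← heq, Measure.restrict_apply hF.compl]
      convert measure_empty (μ := (volume : Measure ℝ))
      exact eq_empty_of_forall_notMem fun t ht => ht.1 ht.2.1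
    rwa [Measure.restrict_apply hF.compl, inter_comm, ← sdiff_eq] at h1
  exact (ae_eq_of_ae_subset_of_measure_ge (ae_le_set.2 hsub) (hvol.trans hE'vol.symm).le
    hE'o.measurableSet.nullMeasurableSet (by rw [hvol]; exact hEfin.ne)).symm

theorem mainTheorem2 (E F : Set ℝ)
    (hE : IsOpenWithLowerBoundedGaps E) (hEfin : volume E < ∞)
    (hF : NullMeasurableSet F volume)
    (hdeck : threeDeck F =ᵐ[volume] threeDeck E) :
    ∃ a : ℝ, F =ᵐ[volume] (a +ᵥ E : Set ℝ) := by
  -- A null change of `F` leaves its 3-deck unchanged at every point, so a Borel representative may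
  -- be used.
  have hae : toMeasurable volume F =ᵐ[volume] F := hF.toMeasurable_ae_eq
  obtain ⟨a, ha⟩ := exists_ae_eq_vadd_of_threeDeck hE hEfin (measurableSet_toMeasurable volume F)
    (by rwa [threeDeck_congr_ae hae])
  exact ⟨a, hae.symm.trans ha⟩
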